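/- A rigid body with principal moments of inertia $0<I_3<I_1<I_2$ carries a rotor about its second principal axis. Its attitude $R(t)\in SO(3)$ obeys $R^tR'\,v=\Omega\times v$ for all $v\in\mathbb R^3$, where $\Omega=\mathrm{diag}(I_1,I_2,I_3)^{-1}\bigl(L-(0,h,0)^t\bigr)$, $L=R^t(l,0,0)^t$ is the angular momentum in the body frame, $l>0$ is constant, and $h$ is the constant angular momentum of the rotor ($h=0$ means ``rotor off''). Put $\delta=I_1/I_2-1$, $\gamma=I_1/I_3-1$, $\nu=\delta/\gamma<0$. Let $R_i(\cdot)$ be the rotation about the $i$-th axis. The tilt of an attitude is the angle in $[-\pi/2,\pi/2]$ whose sine is $L_3/l$. Let $R$ be a ``rotor on'' motion ($h\neq 0$) with $L(0)=(l,0,0)$, written in two systems of differentiable Euler angles, $R=R_1(\phi)R_2(\theta)R_3(\psi)=R_1(\tilde\phi)R_3(\tilde\theta)R_2(\tilde\psi)$, with $\theta(0)=\psi(0)=\tilde\theta(0)=\tilde\psi(0)=0$. Then there is a first time $T_2>0$ at which $|\text{tilt}|$ attains its maximum $\theta_{max}$ along the orbit. Write $\hat T_2=lT_2/I_1$, $\phi_2=\phi(T_2)-\phi(0)$,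 $\tilde\phi_2=\tilde\phi(T_2)-\tilde\phi(0)$, $s_+=\sin\theta_{max}$. There is $s_-\in(0,1)$ with $s_-^2=s_+^2+(1-s_+^2)\nu$; moreover $s_-=\sin\theta_{min}$, where $\theta_{min}$ is the minimum of $|\text{tilt}|$ along any ``rotor off'' motion with the same $l$ that has attitude $R(T_2)$ at time $T_2$. Furthermore \[ \tilde\phi_2-\hat T_2=f_+\,\Pi(n_+,k^2)+f_-\,\Pi(n_-,k^2),\qquad \phi_2=\tilde\phi_2-\frac{\pi}{2}, \] where \[ k^2=\frac{(s_-^{-2}-1)\,(s_-^2(1-\nu)+\nu)}{(2-s_-^2)(1-\nu)},\qquad n_\pm=1-s_-^{-2}\pm s_-^{-2}\sqrt{\frac{1-s_-^2}{1-\nu}}, \] \[ f_\pm=\frac1g\left(1-s_-^2\mp\sqrt{(1-s_-^2)(1-\nu)}\right),\qquad g=s_-\sqrt{(1-s_-^2)(2-s_-^2)(1-\nu)}, \] and \[ \Pi(n,m)=\int_0^{\pi/2}\frac{dx}{(1-n\sin^2x)\sqrt{1-m\sin^2x}} . \] Here $k^2<1$ and $n_\pm<1$, so both integrals converge ($k^2$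 denotes the displayed real quantity, which may be $\le 0$). -/

import Mathlib

noncomputable section

namespace TwistingSomersault

/-- Rotation by the angle `a` about the first axis. -/
def rot1 (a : ℝ) : Matrix (Fin 3) (Fin 3) ℝ :=
  !![1, 0, 0; 0, Real.cos a, -Real.sin a; 0, Real.sin a, Real.cos a]

/-- Rotation by the angle `a` about the second axis. -/
def rot2 (a : ℝ) : Matrix (Fin 3) (Fin 3) ℝ :=
  !![Real.cos a, 0, Real.sin a; 0, 1, 0; -Real.sin a, 0, Real.cos a]

/-- Rotation by the angle `a` about the third axis. -/
def rot3 (a : ℝ) : Matrix (Fin 3) (Fin 3) ℝ :=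
  !![Real.cos a, -Real.sin a, 0; Real.sin a, Real.cos a, 0; 0, 0, 1]

/-- The matrix of the linear map `v ↦ w × v`. -/
def crossMatrix (w : Fin 3 → ℝ) : Matrix (Fin 3) (Fin 3) ℝ :=
  !![0, -w 2, w 1; w 2, 0, -w 0; -w 1, w 0, 0]

/-- The angular momentum in the body frame, `L = Rᵗ (l, 0, 0)ᵗ`: the space-fixed frame is chosen
so that the constant angular momentum is `(l, 0, 0)`. -/
def bodyMomentum (l : ℝ) (R : Matrix (Fin 3) (Fin 3) ℝ) : Fin 3 → ℝ :=
  R.transpose.mulVec ![l, 0, 0]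

/-- The angular velocity in the body frame, `Ω = I⁻¹ (L - A)` with `I = diag (I₁, I₂, I₃)` and the
internal angular momentum `A = (0, h, 0)` of the rotor about the second body axis. -/
def bodyVelocity (I₁ I₂ I₃ l h : ℝ) (R : Matrix (Fin 3) (Fin 3) ℝ) : Fin 3 → ℝ :=
  ![bodyMomentum l R 0 / I₁, (bodyMomentum l R 1 - h) / I₂, bodyMomentum l R 2 / I₃]

/-- `R` (body frame to space frame) is a motion of the free rigid body with principal moments of
inertia `I₁, I₂, I₃`, angular momentum `l` and rotor momentum `h` (`h = 0` is ``rotor off''):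
`R t` is a rotation, and `Ω × v = Rᵗ R' v` for every `v`, that is `R' = R · crossMatrix Ω`. -/
structure IsMotion (I₁ I₂ I₃ l h : ℝ) (R : ℝ → Matrix (Fin 3) (Fin 3) ℝ) : Prop where
  rotation : ∀ t, R t ∈ Matrix.specialOrthogonalGroup (Fin 3) ℝ
  hasDerivAt : ∀ t i j, HasDerivAt (fun τ => R τ i j)
    ((R t * crossMatrix (bodyVelocity I₁ I₂ I₃ l h (R t))) i j) t

/-- The tilt angle in `[-π/2, π/2]` of an attitude `R`; `R 0 2` is the third component of
`Rᵗ e₁`, so it is `sin θ` whenever `R = rot1 φ * rot2 θ * rot3 ψ`. -/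
def tilt (R : Matrix (Fin 3) (Fin 3) ℝ) : ℝ := Real.arcsin (R 0 2)

/-- Legendre's complete elliptic integral of the third kind, as a function of the characteristic
`n` and the parameter `m` (the squared modulus `k²`). -/
def ellipticPi (n m : ℝ) : ℝ :=
  ∫ x in (0 : ℝ)..(Real.pi / 2),
    1 / ((1 - n * Real.sin x ^ 2) * Real.sqrt (1 - m * Real.sin x ^ 2))

/-- The dimensionless parameter `ν = δ / γ`, with `δ = I₁/I₂ - 1` and `γ = I₁/I₃ - 1`. -/
def nu (I₁ I₂ I₃ : ℝ) : ℝ := (I₁ / I₂ - 1) / (I₁ / I₃ - 1)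

/-- The parameter `k²` in terms of `s = s₋` and `ν`. -/
def kSq (s ν : ℝ) : ℝ :=
  ((s ^ 2)⁻¹ - 1) * (s ^ 2 * (1 - ν) + ν) / ((2 - s ^ 2) * (1 - ν))

/-- The quantity `g` in terms of `s = s₋` and `ν`. -/
def gFun (s ν : ℝ) : ℝ := s * Real.sqrt ((1 - s ^ 2) * (2 - s ^ 2) * (1 - ν))

/-- The characteristic `n₊`. -/
def nPlus (s ν : ℝ) : ℝ :=
  1 - (s ^ 2)⁻¹ + (s ^ 2)⁻¹ * Real.sqrt ((1 - s ^ 2) / (1 - ν))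

/-- The characteristic `n₋`. -/
def nMinus (s ν : ℝ) : ℝ :=
  1 - (s ^ 2)⁻¹ - (s ^ 2)⁻¹ * Real.sqrt ((1 - s ^ 2) / (1 - ν))

/-- The coefficient `f₊`. -/
def fPlus (s ν : ℝ) : ℝ :=
  (gFun s ν)⁻¹ * (1 - s ^ 2 - Real.sqrt ((1 - s ^ 2) * (1 - ν)))

/-- The coefficient `f₋`. -/
def fMinus (s ν : ℝ) : ℝ :=
  (gFun s ν)⁻¹ * (1 - s ^ 2 + Real.sqrt ((1 - s ^ 2) * (1 - ν)))

end TwistingSomersault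

end

open Set Filter Topology

namespace TwistingSomersault

/-! The first row of `R` is `L / l`. With `σ` the sign of `h`, the coordinates x = `R 0 0`, y = `σ *
R 0 1`, z = `-σ * R 0 2` satisfy a system with `H > 0`. Its invariants x² + y² + z² = 1 and K₂z² =
2Hy + K₃y² make x² and z² quadratics in y. Since y ≥ 0, z² increases with y, so |tilt| peaks exactly
where x = 0, at y = p. `rotorOn_quarter` provides the first such time T.

The energy at T reads K₂s₋² = 2Hp > 0, so s₋ exists. With the rotor off, K₂z² - K₃y² is conserved
and equals K₂s₋², so |z| is least where y = 0, and y does vanish somewhere (`rotorOff_isLeast`).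

The angle φ̃ is the azimuth of the second body axis about L, and φ̃ - lt/I₁ grows at rate K₂z²/(1 -
y²). As y' = K₂xz, its increment is an elliptic integral in y. The Möbius substitution sin²w = (p -
y)/(p + dy), with d = -νp²/s₋², sends the branch points p, 0, -p/d, -p/(1 - s₋²) to 0, 1, ∞, 1/k²
and the poles -1, 1 to 1/n₊, 1/n₋ (`twist_eq`).

Finally cos θ cos θ̃ exp(i(φ̃ - φ)) = x + iyz. It starts at 1, keeps positive real part before T and
ends on the positive imaginary axis, so φ̃ - φ gains π/2 (`quarter_turn`). -/

theorem eq_of_hasDerivAt_zero {f : ℝ → ℝ} (hf : ∀ t, HasDerivAt f 0 t) (a b : ℝ) : f a = f b :=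
  is_const_of_deriv_eq_zero (fun t => (hf t).differentiableAt) (fun t => (hf t).deriv) a b

/-- A continuous function without zeros that is positive somewhere is positive. -/
theorem pos_of_continuous_of_ne_zero {f : ℝ → ℝ} (hf : Continuous f) (h0 : ∀ t, f t ≠ 0) {a : ℝ}
    (ha : 0 < f a) (t : ℝ) : 0 < f t := by
  by_contra! ht
  obtain ⟨r, hr⟩ := mem_range_of_exists_le_of_exists_ge hf ⟨t, ht⟩ ⟨a, ha.le⟩
  exact h0 r hr

/-! ### The normalised rotor-on orbit -/

/-- The momentum sphere and the energy surface of the normalised rotor-on equations. -/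
theorem rotorOn_conserved {x y z : ℝ → ℝ} {K₂ K₃ H : ℝ} (hK₃ : 0 < K₃)
    (hK₂ : 0 < K₂) (hH : 0 < H)
    (hx : ∀ t, HasDerivAt x (-(z t * ((K₂ + K₃) * y t + H))) t)
    (hy : ∀ t, HasDerivAt y (K₂ * (x t * z t)) t)
    (hz : ∀ t, HasDerivAt z (x t * (K₃ * y t + H)) t)
    (hx0 : x 0 = 1) (hy0 : y 0 = 0) (hz0 : z 0 = 0) (t : ℝ) :
    x t ^ 2 + y t ^ 2 + z t ^ 2 = 1 ∧ K₂ * z t ^ 2 = 2 * H * y t + K₃ * y t ^ 2 ∧ 0 ≤ y t := by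
  have energy : ∀ t, K₂ * z t ^ 2 = 2 * H * y t + K₃ * y t ^ 2 := by
    intro t
    have hd : ∀ t, HasDerivAt (fun t => K₂ * z t ^ 2 - (2 * H * y t + K₃ * y t ^ 2)) 0 t := by
      intro t
      refine ((((hz t).pow 2).const_mul K₂).sub
        (((hy t).const_mul (2 * H)).add (((hy t).pow 2).const_mul K₃))).congr_deriv ?_
      push_cast
      ring
    have := eq_of_hasDerivAt_zero hd t 0
    simp only [hy0, hz0] at this
    linarith
  refine ⟨?_, energy t, ?_⟩
  · have hd : ∀ t, HasDerivAt (fun t => x t ^ 2 + y t ^ 2 + z t ^ 2) 0 t := by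
      intro t
      refine ((((hx t).pow 2).add ((hy t).pow 2)).add ((hz t).pow 2)).congr_deriv ?_
      push_cast
      ring
    have := eq_of_hasDerivAt_zero hd t 0
    simpa [hx0, hy0, hz0] using this
  · by_contra! ht
    have hyc : Continuous y := continuous_iff_continuousAt.2 fun t => (hy t).continuousAt
    -- This level lies in [-H/K₃, 0), where y(2H + K₃y) < 0, and y must cross it to reach 0. The
    -- energy relation forbids that.
    have hneg : max (y t) (-(H / K₃)) < 0 := max_lt ht (by have := div_pos hH hK₃; linarith)
    obtain ⟨r, hr⟩ := mem_range_of_exists_le_of_exists_ge hyc (c := max (y t) (-(H / K₃)))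
      ⟨t, le_max_left _ _⟩ ⟨0, by rw [hy0]; exact hneg.le⟩
    have h1 : -(H / K₃) ≤ y r := hr ▸ le_max_right _ _
    rw [← hr] at hneg
    have h2 : -H ≤ K₃ * y r := by
      have := mul_le_mul_of_nonneg_left h1 hK₃.le
      rwa [mul_neg, mul_div_cancel₀ _ hK₃.ne'] at this
    have h3 := energy r
    have h4 : 0 ≤ K₂ * z r ^ 2 := by positivity
    have h5 : y r * (2 * H + K₃ * y r) < 0 := mul_neg_of_neg_of_pos hneg (by linarith)
    nlinarith

/-- The orbit of the normalised rotor-on equations starts with a quarter period along which `x`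
decreases to zero while `y` and `z` increase. -/
theorem rotorOn_quarter {x y z : ℝ → ℝ} {K₂ K₃ H : ℝ} (hK₃ : 0 < K₃)
    (hK₂ : 0 < K₂) (hH : 0 < H)
    (hx : ∀ t, HasDerivAt x (-(z t * ((K₂ + K₃) * y t + H))) t)
    (hy : ∀ t, HasDerivAt y (K₂ * (x t * z t)) t)
    (hz : ∀ t, HasDerivAt z (x t * (K₃ * y t + H)) t)
    (hx0 : x 0 = 1) (hy0 : y 0 = 0) (hz0 : z 0 = 0) :
    ∃ T, 0 < T ∧ x T = 0 ∧ (∀ t, 0 ≤ t → t < T → 0 < x t) ∧ (∀ t, 0 < t → t ≤ T → 0 < z t) ∧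
      StrictMonoOn y (Icc 0 T) := by
  have cons := rotorOn_conserved hK₃ hK₂ hH hx hy hz hx0 hy0 hz0
  have hxc : Continuous x := continuous_iff_continuousAt.2 fun t => (hx t).continuousAt
  have hyc : Continuous y := continuous_iff_continuousAt.2 fun t => (hy t).continuousAt
  have hzc : Continuous z := continuous_iff_continuousAt.2 fun t => (hz t).continuousAt
  have hpos : ∀ t, 0 < K₃ * y t + H := fun t =>
    add_pos_of_nonneg_of_pos (mul_nonneg hK₃.le (cons t).2.2) hH
  have hex : ∃ t, 0 ≤ t ∧ x t ≤ 0 := by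
    -- If x stayed positive, z would increase, so x' ≤ -H z(1) from time 1 on and x would become
    -- negative.
    by_contra! hall
    have hmono : StrictMonoOn z (Ici 0) := by
      refine strictMonoOn_of_deriv_pos (convex_Ici 0) hzc.continuousOn fun t ht => ?_
      rw [interior_Ici] at ht
      rw [(hz t).deriv]
      exact mul_pos (hall t (le_of_lt ht)) (hpos t)
    have hz1 : 0 < z 1 := by
      have := hmono (mem_Ici.2 le_rfl) (mem_Ici.2 zero_le_one) zero_lt_one
      rwa [hz0] at this
    have hC : 0 < z 1 * H := mul_pos hz1 hH
    have hle := (convex_Ici (1 : ℝ)).image_sub_le_mul_sub_of_deriv_le hxc.continuousOn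
      (fun t _ => (hx t).differentiableAt.differentiableWithinAt) (C := -(z 1 * H))
      (fun t ht => by
        rw [interior_Ici] at ht
        have ht1 : (1 : ℝ) < t := ht
        rw [(hx t).deriv, neg_le_neg_iff]
        have hzt : z 1 ≤ z t :=
          (hmono (mem_Ici.2 zero_le_one) (mem_Ici.2 (by linarith)) ht1).le
        have hyt : 0 ≤ (K₂ + K₃) * y t := mul_nonneg (by linarith) (cons t).2.2
        exact mul_le_mul hzt (by linarith) hH.le (hz1.le.trans hzt))
      1 (mem_Ici.2 le_rfl) (1 + 2 / (z 1 * H)) (mem_Ici.2 (by have := div_pos two_pos hC; linarith))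
      (by have := div_pos two_pos hC; linarith)
    -- The waiting time 2/(H z(1)) lowers x by at least 2, while x(1) ≤ 1.
    have h1 : -(z 1 * H) * (1 + 2 / (z 1 * H) - 1) = -2 := by field_simp; ring
    rw [h1] at hle
    have h2 := hall (1 + 2 / (z 1 * H)) (by positivity)
    have h3 : x 1 ≤ 1 := by
      have := (cons 1).1
      nlinarith [sq_nonneg (y 1), sq_nonneg (z 1)]
    linarith
  obtain ⟨b, hb0, hb⟩ := hex
  have hne : (Ici 0 ∩ x ⁻¹' {0}).Nonempty := by
    have := intermediate_value_Icc' hb0 hxc.continuousOn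
    obtain ⟨r, hr, hr0⟩ := this ⟨hb, by rw [hx0]; exact zero_le_one⟩
    exact ⟨r, hr.1, hr0⟩
  have hleast := (isClosed_Ici.inter (isClosed_singleton.preimage hxc)).isLeast_csInf hne
    ⟨0, fun t ht => ht.1⟩
  set T := sInf (Ici 0 ∩ x ⁻¹' {0}) with hT
  have hxT : x T = 0 := hleast.1.2
  have hT0 : 0 < T := by
    refine lt_of_le_of_ne hleast.1.1 fun h => ?_
    rw [← h, hx0] at hxT
    exact one_ne_zero hxT
  have hxpos : ∀ t, 0 ≤ t → t < T → 0 < x t := by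
    intro t ht htT
    by_contra! hneg
    obtain ⟨r, hr, hr0⟩ := intermediate_value_Icc' ht hxc.continuousOn
      ⟨hneg, by rw [hx0]; exact zero_le_one⟩
    have := hleast.2 ⟨hr.1, hr0⟩
    linarith [hr.2]
  have hzmono : StrictMonoOn z (Icc 0 T) := by
    refine strictMonoOn_of_deriv_pos (convex_Icc 0 T) hzc.continuousOn fun t ht => ?_
    rw [interior_Icc] at ht
    rw [(hz t).deriv]
    exact mul_pos (hxpos t ht.1.le ht.2) (hpos t)
  have hzpos : ∀ t, 0 < t → t ≤ T → 0 < z t := fun t ht htT => by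
    have := hzmono ⟨le_rfl, hT0.le⟩ ⟨ht.le, htT⟩ ht
    rwa [hz0] at this
  refine ⟨T, hT0, hxT, hxpos, hzpos, ?_⟩
  refine strictMonoOn_of_deriv_pos (convex_Icc 0 T) hyc.continuousOn fun t ht => ?_
  rw [interior_Icc] at ht
  rw [(hy t).deriv]
  exact mul_pos hK₂ (mul_pos (hxpos t ht.1.le ht.2) (hzpos t ht.1 ht.2.le))

/-! ### The rotor-off orbit and its minimal tilt -/

/-- Along a rotor-off orbit whose third component stays away from zero, the second component
vanishes somewhere. -/
theorem rotorOff_exists_zero {x₁ x₂ x₃ : ℝ → ℝ} {K₂ K₃ s : ℝ} (hK₂ : 0 < K₂) (hK₃ : 0 ≤ K₃)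
    (hs : 0 < s)
    (h₁ : ∀ t, HasDerivAt x₁ ((K₂ + K₃) * (x₂ t * x₃ t)) t)
    (h₂ : ∀ t, HasDerivAt x₂ (-(K₂ * (x₁ t * x₃ t))) t)
    (h₃ : ∀ t, s ≤ x₃ t) : ∃ t, x₂ t = 0 := by
  by_contra! hne
  -- The point (x₁, x₂) turns at rate x₃(K₂ + K₃x₂²/(x₁² + x₂²)) ≥ K₂s. Without a zero of x₂ this
  -- angle would stay in an interval of length π forever.
  have hd : ∀ t, HasDerivAt (fun t => Real.arctan (x₁ t / x₂ t))
      (1 / (1 + (x₁ t / x₂ t) ^ 2) * (((K₂ + K₃) * (x₂ t * x₃ t) * x₂ t -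
        x₁ t * (-(K₂ * (x₁ t * x₃ t)))) / x₂ t ^ 2)) t :=
    fun t => ((h₁ t).div (h₂ t) (hne t)).arctan
  have hlow : ∀ t, K₂ * s ≤ deriv (fun t => Real.arctan (x₁ t / x₂ t)) t := by
    intro t
    have h2 : 0 < x₂ t ^ 2 := by have := hne t; positivity
    have hden : 0 < x₂ t ^ 2 + x₁ t ^ 2 := by positivity
    have hrw : 1 / (1 + (x₁ t / x₂ t) ^ 2) * (((K₂ + K₃) * (x₂ t * x₃ t) * x₂ t -
        x₁ t * (-(K₂ * (x₁ t * x₃ t)))) / x₂ t ^ 2) =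
        x₃ t * (K₂ + K₃ * (x₂ t ^ 2 / (x₂ t ^ 2 + x₁ t ^ 2))) := by
      have := hne t
      field_simp
      ring
    rw [(hd t).deriv, hrw, mul_comm]
    refine mul_le_mul (h₃ t) ?_ hK₂.le (hs.le.trans (h₃ t))
    have : 0 ≤ K₃ * (x₂ t ^ 2 / (x₂ t ^ 2 + x₁ t ^ 2)) := by positivity
    linarith
  have hC : 0 < K₂ * s := mul_pos hK₂ hs
  have hgrow := mul_sub_le_image_sub_of_le_deriv (fun t => (hd t).differentiableAt) hlow
    (show (0 : ℝ) ≤ Real.pi / (K₂ * s) by positivity)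
  rw [sub_zero, mul_div_cancel₀ _ hC.ne'] at hgrow
  have h1 := Real.arctan_lt_pi_div_two (x₁ (Real.pi / (K₂ * s)) / x₂ (Real.pi / (K₂ * s)))
  have h2 := Real.neg_pi_div_two_lt_arctan (x₁ 0 / x₂ 0)
  linarith

/-- The minimum of `|x₃|` along a rotor-off orbit through a point with `x₃² - (K₃ / K₂) x₂² = s²`. -/
theorem rotorOff_isLeast {x₁ x₂ x₃ : ℝ → ℝ} {K₂ K₃ s t₀ : ℝ} (hK₂ : 0 < K₂) (hK₃ : 0 ≤ K₃)
    (hs : 0 < s)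
    (h₁ : ∀ t, HasDerivAt x₁ ((K₂ + K₃) * (x₂ t * x₃ t)) t)
    (h₂ : ∀ t, HasDerivAt x₂ (-(K₂ * (x₁ t * x₃ t))) t)
    (h₃ : ∀ t, HasDerivAt x₃ (-(K₃ * (x₁ t * x₂ t))) t)
    (h₀ : K₂ * x₃ t₀ ^ 2 - K₃ * x₂ t₀ ^ 2 = K₂ * s ^ 2) :
    IsLeast (range fun t => |x₃ t|) s := by
  have cons : ∀ t, K₂ * x₃ t ^ 2 - K₃ * x₂ t ^ 2 = K₂ * s ^ 2 := by
    intro t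
    rw [← h₀]
    refine eq_of_hasDerivAt_zero (f := fun t => K₂ * x₃ t ^ 2 - K₃ * x₂ t ^ 2) (fun t => ?_) t t₀
    refine ((((h₃ t).pow 2).const_mul K₂).sub (((h₂ t).pow 2).const_mul K₃)).congr_deriv ?_
    push_cast
    ring
  have hlow : ∀ t, s ≤ |x₃ t| := by
    intro t
    refine abs_le_of_sq_le_sq' ?_ (abs_nonneg _) |>.2
    rw [sq_abs]
    have : 0 ≤ K₃ * x₂ t ^ 2 := by positivity
    nlinarith [cons t]
  refine ⟨?_, by rintro _ ⟨t, rfl⟩; exact hlow t⟩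
  have hc : Continuous x₃ := continuous_iff_continuousAt.2 fun t => (h₃ t).continuousAt
  have hne : ∀ t, x₃ t ≠ 0 := fun t => abs_pos.1 (hs.trans_le (hlow t))
  have hzero : ∃ t, x₂ t = 0 := by
    rcases lt_or_gt_of_ne (hne 0) with hneg | hpos
    · have hall := pos_of_continuous_of_ne_zero hc.neg (fun t => neg_ne_zero.2 (hne t))
        (neg_pos.2 hneg)
      -- Changing the signs of x₁ and x₃ together is a symmetry of the equations.
      refine rotorOff_exists_zero (x₁ := fun t => -x₁ t) (x₃ := fun t => -x₃ t) hK₂ hK₃ hs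
        (fun t => (h₁ t).neg.congr_deriv (by ring)) (fun t => (h₂ t).congr_deriv (by ring))
        fun t => ?_
      have := hlow t
      rwa [abs_of_neg (neg_pos.1 (hall t))] at this
    · have hall := pos_of_continuous_of_ne_zero hc hne hpos
      refine rotorOff_exists_zero hK₂ hK₃ hs h₁ h₂ fun t => ?_
      have := hlow t
      rwa [abs_of_pos (hall t)] at this
  obtain ⟨t, ht⟩ := hzero
  refine ⟨t, ?_⟩
  have := cons t
  rw [ht] at this
  have hsq : x₃ t ^ 2 = s ^ 2 := by
    refine mul_left_cancel₀ hK₂.ne' ?_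
    linarith
  simpa [abs_of_pos hs] using (sq_eq_sq_iff_abs_eq_abs _ _).1 hsq

/-! ### Reduction of the twist integral to Legendre's form -/

/-- The closed forms of the parameters in terms of `p`, the maximum of the second component. -/
theorem params_eq {s ν p : ℝ} (hs : 0 < s) (hs1 : s < 1) (hν : ν < 0) (hp : 0 < p)
    (hps : p ^ 2 * (1 - ν) = 1 - s ^ 2) :
    Real.sqrt ((1 - s ^ 2) / (1 - ν)) = p ∧
    fPlus s ν = (p - 1) / (s * Real.sqrt (2 - s ^ 2)) ∧
    fMinus s ν = (p + 1) / (s * Real.sqrt (2 - s ^ 2)) ∧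
    kSq s ν = (1 - s ^ 2 + ν * p ^ 2 / s ^ 2) / (2 - s ^ 2) := by
  have h1ν : 0 < 1 - ν := by linarith
  have hss : 0 < 2 - s ^ 2 := by nlinarith
  have hb : 0 < Real.sqrt (2 - s ^ 2) := Real.sqrt_pos.2 hss
  -- Replacing 1 - s² by p²(1 - ν) turns the radicals containing 1 - ν into perfect squares.
  have h1 : Real.sqrt ((1 - s ^ 2) / (1 - ν)) = p := by
    rw [← hps, mul_div_assoc, div_self h1ν.ne', mul_one, Real.sqrt_sq hp.le]
  have h2 : Real.sqrt ((1 - s ^ 2) * (1 - ν)) = p * (1 - ν) := by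
    rw [← hps, show p ^ 2 * (1 - ν) * (1 - ν) = (p * (1 - ν)) ^ 2 by ring,
      Real.sqrt_sq (by positivity)]
  have h3 : gFun s ν = s * (p * (1 - ν) * Real.sqrt (2 - s ^ 2)) := by
    rw [gFun, ← h2, ← Real.sqrt_mul (by rw [← hps]; positivity)]
    congr 2
    ring
  refine ⟨h1, ?_, ?_, ?_⟩
  · rw [fPlus, h3, h2, ← hps]
    field_simp
  · rw [fMinus, h3, h2, ← hps]
    field_simp
  · have hsν : s ^ 2 = 1 - p ^ 2 * (1 - ν) := by linarith
    rw [kSq]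
    have hs2 : s ^ 2 ≠ 0 := by positivity
    field_simp
    rw [hsν]
    ring

/-- The bounds that make both elliptic integrals converge. -/
theorem params_lt_one {s ν p : ℝ} (hs : 0 < s) (hs1 : s < 1) (hν : ν < 0) (hp : 0 < p)
    (hps : p ^ 2 * (1 - ν) = 1 - s ^ 2) :
    kSq s ν < 1 ∧ nPlus s ν < 1 ∧ nMinus s ν < 1 := by
  obtain ⟨h1, -, -, h4⟩ := params_eq hs hs1 hν hp hps
  have hp1 : p < 1 := by
    have h : 0 < p ^ 2 * (-ν) := by have : 0 < -ν := by linarith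
                                    positivity
    nlinarith [sq_nonneg s]
  have hinv : 0 < (s ^ 2)⁻¹ := by positivity
  have hss : 0 < 2 - s ^ 2 := by nlinarith
  refine ⟨?_, ?_, ?_⟩
  · rw [h4, div_lt_one hss]
    have : ν * p ^ 2 / s ^ 2 ≤ 0 :=
      div_nonpos_of_nonpos_of_nonneg (mul_nonpos_of_nonpos_of_nonneg hν.le (sq_nonneg p))
        (sq_nonneg s)
    linarith
  · rw [nPlus, h1]
    nlinarith
  · rw [nMinus, h1]
    nlinarith

theorem one_sub_mul_pos {n X : ℝ} (hn : n < 1) (hX0 : 0 ≤ X) (hX1 : X ≤ 1) : 0 < 1 - n * X := by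
  rcases le_or_gt n 0 with h | h
  · nlinarith
  · nlinarith

/-- The integrand of `fPlus * Π(nPlus, k²) + fMinus * Π(nMinus, k²)` as a single fraction, in terms
of `X = sin² x`. -/
theorem integrand_eq {s ν p X Δ : ℝ} (hs : 0 < s) (hs1 : s < 1) (hν : ν < 0) (hp : 0 < p)
    (hps : p ^ 2 * (1 - ν) = 1 - s ^ 2) (hX0 : 0 ≤ X) (hX1 : X ≤ 1) (hΔ : 0 < Δ) :
    fPlus s ν * (1 / ((1 - nPlus s ν * X) * Δ)) + fMinus s ν * (1 / ((1 - nMinus s ν * X) * Δ)) =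
      2 * p / (s * Real.sqrt (2 - s ^ 2)) *
        ((1 - X) / ((1 - nPlus s ν * X) * (1 - nMinus s ν * X) * Δ)) := by
  obtain ⟨h1, h2, h3, -⟩ := params_eq hs hs1 hν hp hps
  obtain ⟨-, h5, h6⟩ := params_lt_one hs hs1 hν hp hps
  have hb : 0 < Real.sqrt (2 - s ^ 2) := Real.sqrt_pos.2 (by nlinarith)
  have hP := one_sub_mul_pos h5 hX0 hX1
  have hM := one_sub_mul_pos h6 hX0 hX1
  -- With n_± = 1 - (1 ∓ p)/s², the weights p ∓ 1 make the partial fractions combine to a multiple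
  -- of 1 - X.
  have key : (p - 1) * (1 - nMinus s ν * X) + (p + 1) * (1 - nPlus s ν * X) =
      2 * p * (1 - X) := by
    rw [nMinus, nPlus, h1]
    field_simp
    ring
  rw [h2, h3]
  generalize 1 - nPlus s ν * X = P at *
  generalize 1 - nMinus s ν * X = M at *
  field_simp
  linarith

theorem one_sub_mul_sin_sq_pos {n : ℝ} (hn : n < 1) (v : ℝ) : 0 < 1 - n * Real.sin v ^ 2 :=
  one_sub_mul_pos hn (sq_nonneg _) (Real.sin_sq_le_one v)

theorem continuous_ellipticPi_integrand {n m : ℝ} (hn : n < 1) (hm : m < 1) :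
    Continuous fun v : ℝ =>
      1 / ((1 - n * Real.sin v ^ 2) * Real.sqrt (1 - m * Real.sin v ^ 2)) := by
  refine continuous_const.div (by fun_prop) fun v => ?_
  exact (mul_pos (one_sub_mul_sin_sq_pos hn v)
    (Real.sqrt_pos.2 (one_sub_mul_sin_sq_pos hm v))).ne'

/-- Algebra of the substitution `sin² w = (p - y) / (p + d y)`. -/
theorem substitution_identity {K s ν p d y x z X : ℝ} (hs : 0 < s) (hs1 : s < 1) (hν : ν < 0)
    (hp : 0 < p) (hps : p ^ 2 * (1 - ν) = 1 - s ^ 2) (hd : d = -ν * p ^ 2 / s ^ 2)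
    (hy : 0 < y) (hyp : y < p) (hx : 0 < x) (hz : 0 < z)
    (hx2 : x ^ 2 = (1 - y / p) * (1 + (1 - s ^ 2) * (y / p)))
    (hz2 : z ^ 2 = s ^ 2 * (y / p) - ν * y ^ 2) (hX : X = (p - y) / (p + d * y)) :
    2 * p / (s * Real.sqrt (2 - s ^ 2)) *
        ((1 - X) / ((1 - nPlus s ν * X) * (1 - nMinus s ν * X) * Real.sqrt (1 - kSq s ν * X))) *
        (1 / Real.sqrt (1 - X) * (-(p * (1 + d)) * (K * (x * z)) / (p + d * y) ^ 2 /
          (2 * Real.sqrt X))) =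
      -(K * z ^ 2 / (1 - y ^ 2)) := by
  obtain ⟨h1, -, -, h4⟩ := params_eq hs hs1 hν hp hps
  obtain ⟨hk, hn1, hn2⟩ := params_lt_one hs hs1 hν hp hps
  have hd0 : 0 < d := by
    rw [hd]
    have : 0 < -ν := by linarith
    positivity
  have hD : 0 < p + d * y := by positivity
  have hss : 0 < 2 - s ^ 2 := by nlinarith
  have hX0 : 0 < X := by rw [hX]; exact div_pos (by linarith) hD
  have hXe : 1 - X = (1 + d) * y / (p + d * y) := by rw [hX]; field_simp; ring
  have hX1 : 0 < 1 - X := by rw [hXe]; positivity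
  have hkX : 0 < 1 - kSq s ν * X := one_sub_mul_pos hk hX0.le (by linarith)
  have hp1 : p < 1 := by
    have h : 0 < p ^ 2 * (-ν) := by have : 0 < -ν := by linarith
                                    positivity
    nlinarith [sq_nonneg s]
  have hd1 : s ^ 2 * (1 + d) = 1 - p ^ 2 := by
    rw [hd]
    field_simp
    linarith
  have hνd : ν * p ^ 2 = -(d * s ^ 2) := by
    rw [hd]
    field_simp
  -- The roots of z² in y are 0 and -p/d, which explains the choice of d: p + dy is a factor of z².
  have hz2' : z ^ 2 = s ^ 2 * y * (p + d * y) / p ^ 2 := by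
    rw [hz2]
    field_simp
    linear_combination -y * hνd
  -- the Jacobian
  have hroot : x * z * (1 + d) * p ^ 2 =
      s * Real.sqrt (2 - s ^ 2) * (p + d * y) ^ 2 *
        (Real.sqrt X * Real.sqrt (1 - X) * Real.sqrt (1 - kSq s ν * X)) := by
    -- The factor 1 - k²X carries the remaining root y = -p/(1 - s²) of x².
    have hkXe : (2 - s ^ 2) * (1 - kSq s ν * X) =
        (1 + d) * (p + (1 - s ^ 2) * y) / (p + d * y) := by
      have : ν * p ^ 2 / s ^ 2 = -d := by rw [hd]; ring
      rw [h4, this, hX]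
      field_simp
      ring
    refine (sq_eq_sq₀ (by positivity) (by positivity)).1 ?_
    have e1 : (s * Real.sqrt (2 - s ^ 2) * (p + d * y) ^ 2 *
        (Real.sqrt X * Real.sqrt (1 - X) * Real.sqrt (1 - kSq s ν * X))) ^ 2 =
        s ^ 2 * (p + d * y) ^ 4 * X * (1 - X) * ((2 - s ^ 2) * (1 - kSq s ν * X)) := by
      simp only [mul_pow, Real.sq_sqrt hss.le, Real.sq_sqrt hX0.le, Real.sq_sqrt hX1.le,
        Real.sq_sqrt hkX.le]
      ring
    have e2 : (x * z * (1 + d) * p ^ 2) ^ 2 =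
        x ^ 2 * z ^ 2 * (1 + d) ^ 2 * p ^ 4 := by ring
    rw [e1, e2, hx2, hz2', hkXe, hXe, hX]
    field_simp
  -- the denominator
  have hden : (1 - nPlus s ν * X) * (1 - nMinus s ν * X) * (1 - p ^ 2) * (p + d * y) ^ 2 =
      p ^ 2 * (1 + d) ^ 2 * (1 - y ^ 2) := by
    -- Up to the denominator p + dy, the factors with n₊ and n₋ are multiples of 1 + y and 1 - y;
    -- this is `e4` and `e5`.
    have e1 : (1 + p) * nPlus s ν = p - d := by
      rw [nPlus, h1]
      field_simp
      linear_combination hd1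
    have e2 : (1 - p) * nMinus s ν = -(p + d) := by
      rw [nMinus, h1]
      field_simp
      linear_combination hd1
    have e3 : X * (p + d * y) = p - y := by rw [hX]; field_simp
    have e4 : (1 + p) * (1 - nPlus s ν * X) * (p + d * y) = p * (1 + d) * (1 + y) := by
      linear_combination -X * (p + d * y) * e1 - (p - d) * e3
    have e5 : (1 - p) * (1 - nMinus s ν * X) * (p + d * y) = p * (1 + d) * (1 - y) := by
      linear_combination -X * (p + d * y) * e2 + (p + d) * e3
    linear_combination (1 - p) * (1 - nMinus s ν * X) * (p + d * y) * e4 +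
      p * (1 + d) * (1 + y) * e5
  have hP := one_sub_mul_pos hn1 hX0.le (by linarith)
  have hM := one_sub_mul_pos hn2 hX0.le (by linarith)
  have hy1 : 0 < 1 - y ^ 2 := by nlinarith
  have hfin : (1 - X) * (1 - y ^ 2) =
      z ^ 2 * ((1 - nPlus s ν * X) * (1 - nMinus s ν * X)) := by
    rw [hXe, hz2']
    rw [← hd1] at hden
    field_simp
    have h1d : (1 + d) ≠ 0 := by positivity
    refine mul_left_cancel₀ h1d ?_
    linear_combination -hden
  have hr1 : 0 < Real.sqrt X := Real.sqrt_pos.2 hX0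
  have hr2 : 0 < Real.sqrt (1 - X) := Real.sqrt_pos.2 hX1
  have hr3 : 0 < Real.sqrt (1 - kSq s ν * X) := Real.sqrt_pos.2 hkX
  have hb : 0 < Real.sqrt (2 - s ^ 2) := Real.sqrt_pos.2 hss
  generalize 1 - nPlus s ν * X = P at *
  generalize 1 - nMinus s ν * X = M at *
  generalize Real.sqrt X = r₁ at *
  generalize Real.sqrt (1 - X) = r₂ at *
  generalize Real.sqrt (1 - kSq s ν * X) = r₃ at *
  generalize Real.sqrt (2 - s ^ 2) = b at *
  have e : 2 * p / (s * b) * ((1 - X) / (P * M * r₃)) *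
      (1 / r₂ * (-(p * (1 + d)) * (K * (x * z)) / (p + d * y) ^ 2 / (2 * r₁))) =
      -(K * (1 - X) / (P * M)) *
        (x * z * (1 + d) * p ^ 2 / (s * b * (p + d * y) ^ 2 * (r₁ * r₂ * r₃))) := by
    field_simp
  rw [e, hroot, div_self (by positivity), mul_one, neg_inj, div_eq_div_iff (by positivity) hy1.ne']
  linear_combination K * hfin

/-- The twist integral in Legendre's normal form. -/
theorem twist_eq {x y z E : ℝ → ℝ} {K s ν p T : ℝ} (hs : 0 < s) (hs1 : s < 1)
    (hν : ν < 0) (hp : 0 < p) (hps : p ^ 2 * (1 - ν) = 1 - s ^ 2) (hT : 0 < T)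
    (hy : ∀ t, HasDerivAt y (K * (x t * z t)) t) (hy0 : y 0 = 0) (hyT : y T = p)
    (hmono : StrictMonoOn y (Icc 0 T))
    (hx : ∀ t, 0 < t → t < T → 0 < x t) (hz : ∀ t, 0 < t → t < T → 0 < z t)
    (hx2 : ∀ t, x t ^ 2 = (1 - y t / p) * (1 + (1 - s ^ 2) * (y t / p)))
    (hz2 : ∀ t, z t ^ 2 = s ^ 2 * (y t / p) - ν * y t ^ 2)
    (hE : ∀ t ∈ Icc 0 T, HasDerivAt E (K * z t ^ 2 / (1 - y t ^ 2)) t) :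
    E T - E 0 = fPlus s ν * ellipticPi (nPlus s ν) (kSq s ν) +
      fMinus s ν * ellipticPi (nMinus s ν) (kSq s ν) := by
  obtain ⟨hk, hn1, hn2⟩ := params_lt_one hs hs1 hν hp hps
  have hGp := continuous_ellipticPi_integrand hn1 hk
  have hGm := continuous_ellipticPi_integrand hn2 hk
  set Gp : ℝ → ℝ := fun v =>
    1 / ((1 - nPlus s ν * Real.sin v ^ 2) * Real.sqrt (1 - kSq s ν * Real.sin v ^ 2)) with hGpdef
  set Gm : ℝ → ℝ := fun v =>
    1 / ((1 - nMinus s ν * Real.sin v ^ 2) * Real.sqrt (1 - kSq s ν * Real.sin v ^ 2)) with hGmdef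
  set F : ℝ → ℝ := fun w =>
    fPlus s ν * (∫ v in (0 : ℝ)..w, Gp v) + fMinus s ν * (∫ v in (0 : ℝ)..w, Gm v) with hFdef
  have hF : ∀ w, HasDerivAt F (fPlus s ν * Gp w + fMinus s ν * Gm w) w := fun w =>
    ((hGp.integral_hasStrictDerivAt 0 w).hasDerivAt.const_mul _).add
      ((hGm.integral_hasStrictDerivAt 0 w).hasDerivAt.const_mul _)
  obtain ⟨d, hd⟩ : ∃ d, d = -ν * p ^ 2 / s ^ 2 := ⟨_, rfl⟩
  have hd0 : 0 < d := by
    rw [hd]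
    have : 0 < -ν := by linarith
    positivity
  have hyc : Continuous y := continuous_iff_continuousAt.2 fun t => (hy t).continuousAt
  have hyr : ∀ t ∈ Icc 0 T, 0 ≤ y t := fun t ht => by
    have := hmono.monotoneOn ⟨le_rfl, hT.le⟩ ht ht.1
    rwa [hy0] at this
  have hD : ∀ t ∈ Icc 0 T, 0 < p + d * y t := fun t ht =>
    add_pos_of_pos_of_nonneg hp (mul_nonneg hd0.le (hyr t ht))
  set X : ℝ → ℝ := fun t => (p - y t) / (p + d * y t) with hXdef
  have hXc : ContinuousOn X (Icc 0 T) :=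
    ContinuousOn.div (by fun_prop) (by fun_prop) fun t ht => (hD t ht).ne'
  set w : ℝ → ℝ := fun t => Real.arcsin (Real.sqrt (X t)) with hwdef
  have hFc : Continuous F := continuous_iff_continuousAt.2 fun v => (hF v).continuousAt
  have hwc : ContinuousOn w (Icc 0 T) :=
    Real.continuous_arcsin.comp_continuousOn (Real.continuous_sqrt.comp_continuousOn hXc)
  have hEc : ContinuousOn E (Icc 0 T) := fun t ht => (hE t ht).continuousAt.continuousWithinAt
  -- Here w is the new variable and F its Legendre primitive; the substitution identity says that E
  -- and -F ∘ w have the same rate.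
  have hder : ∀ t ∈ Ioo 0 T, HasDerivAt (fun t => E t + F (w t)) 0 t := by
    intro t ht
    have htI : t ∈ Icc 0 T := Ioo_subset_Icc_self ht
    have hy1 : 0 < y t := by
      have := hmono ⟨le_rfl, hT.le⟩ htI ht.1
      rwa [hy0] at this
    have hy2 : y t < p := by
      have := hmono htI ⟨hT.le, le_rfl⟩ ht.2
      rwa [hyT] at this
    have hDt := hD t htI
    have hX0 : 0 < X t := div_pos (by linarith) hDt
    have hX1 : X t < 1 := by
      rw [hXdef, div_lt_one hDt]
      have := mul_pos hd0 hy1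
      linarith
    have hsq1 : Real.sqrt (X t) < 1 := by rwa [Real.sqrt_lt' one_pos, one_pow]
    have hXd : HasDerivAt X (-(p * (1 + d)) * (K * (x t * z t)) / (p + d * y t) ^ 2) t := by
      refine (((hy t).const_sub p).div (((hy t).const_mul d).const_add p)
        hDt.ne').congr_deriv ?_
      ring
    have hwd := (Real.hasDerivAt_arcsin (by linarith [Real.sqrt_nonneg (X t)]) hsq1.ne).comp t
      (hXd.sqrt hX0.ne')
    have hsin : Real.sin (w t) ^ 2 = X t := by
      rw [hwdef]
      simp only
      rw [Real.sin_arcsin (by linarith [Real.sqrt_nonneg (X t)]) hsq1.le, Real.sq_sqrt hX0.le]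
    refine ((hE t htI).add ((hF (w t)).comp t hwd)).congr_deriv ?_
    rw [hGpdef, hGmdef]
    simp only [hsin]
    rw [integrand_eq hs hs1 hν hp hps hX0.le hX1.le
      (Real.sqrt_pos.2 (one_sub_mul_pos hk hX0.le hX1.le)), Real.sq_sqrt hX0.le,
      substitution_identity hs hs1 hν hp hps hd hy1 hy2 (hx t ht.1 ht.2) (hz t ht.1 ht.2)
        (hx2 t) (hz2 t) rfl]
    ring
  -- The function arcsin √X need not be differentiable where X is 0 or 1, that is at T and 0. The
  -- mean value theorem needs only continuity there.
  have hconst : E T + F (w T) = E 0 + F (w 0) := by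
    obtain ⟨r, hr, hr'⟩ := exists_hasDerivAt_eq_slope (fun t => E t + F (w t)) (fun _ => 0) hT
      (hEc.add (hFc.comp_continuousOn hwc)) hder
    rw [eq_div_iff (by linarith)] at hr'
    linarith
  have hwT : w T = 0 := by simp [hwdef, hXdef, hyT]
  have hw0 : w 0 = Real.pi / 2 := by simp [hwdef, hXdef, hy0, hp.ne']
  rw [hwT, hw0] at hconst
  have hF0 : F 0 = 0 := by simp [hFdef]
  have hFpi : F (Real.pi / 2) = fPlus s ν * ellipticPi (nPlus s ν) (kSq s ν) +
      fMinus s ν * ellipticPi (nMinus s ν) (kSq s ν) := rfl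
  rw [← hFpi]
  linarith

/-! ### Equations of motion and tilt in matrix entries -/

theorem bodyMomentum_apply (l : ℝ) (R : Matrix (Fin 3) (Fin 3) ℝ) (i : Fin 3) :
    bodyMomentum l R i = l * R 0 i := by
  simp [bodyMomentum, Matrix.mulVec, dotProduct, Fin.sum_univ_three, mul_comm]

theorem mul_crossMatrix_apply (R : Matrix (Fin 3) (Fin 3) ℝ) (w : Fin 3 → ℝ) (i : Fin 3) :
    (R * crossMatrix w) i 0 = R i 1 * w 2 - R i 2 * w 1 ∧
    (R * crossMatrix w) i 1 = R i 2 * w 0 - R i 0 * w 2 ∧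
    (R * crossMatrix w) i 2 = R i 0 * w 1 - R i 1 * w 0 := by
  refine ⟨?_, ?_, ?_⟩ <;> simp [Matrix.mul_apply, Fin.sum_univ_three, crossMatrix] <;> ring

theorem bodyVelocity_apply (I₁ I₂ I₃ l h : ℝ) (R : Matrix (Fin 3) (Fin 3) ℝ) :
    bodyVelocity I₁ I₂ I₃ l h R 0 = l * R 0 0 / I₁ ∧
    bodyVelocity I₁ I₂ I₃ l h R 1 = (l * R 0 1 - h) / I₂ ∧
    bodyVelocity I₁ I₂ I₃ l h R 2 = l * R 0 2 / I₃ := by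
  simp [bodyVelocity, bodyMomentum_apply]

/-- Euler's equations with a rotor, for the direction `R 0` of the body momentum. -/
theorem IsMotion.hasDerivAt_row {I₁ I₂ I₃ l h : ℝ} {R : ℝ → Matrix (Fin 3) (Fin 3) ℝ}
    (hR : IsMotion I₁ I₂ I₃ l h R) (t : ℝ) :
    HasDerivAt (fun t => R t 0 0) (R t 0 2 * ((l / I₃ - l / I₂) * R t 0 1 + h / I₂)) t ∧
    HasDerivAt (fun t => R t 0 1) (-((l / I₃ - l / I₁) * (R t 0 0 * R t 0 2))) t ∧
    HasDerivAt (fun t => R t 0 2) (-(R t 0 0 * ((l / I₁ - l / I₂) * R t 0 1 + h / I₂))) t := by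
  obtain ⟨w0, w1, w2⟩ := bodyVelocity_apply I₁ I₂ I₃ l h (R t)
  obtain ⟨e0, e1, e2⟩ := mul_crossMatrix_apply (R t) (bodyVelocity I₁ I₂ I₃ l h (R t)) 0
  refine ⟨(hR.hasDerivAt t 0 0).congr_deriv ?_, (hR.hasDerivAt t 0 1).congr_deriv ?_,
    (hR.hasDerivAt t 0 2).congr_deriv ?_⟩
  · rw [e0, w1, w2]; ring
  · rw [e1, w0, w2]; ring
  · rw [e2, w0, w1]; ring

theorem abs_apply_le_one {R : Matrix (Fin 3) (Fin 3) ℝ}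
    (hR : R ∈ Matrix.specialOrthogonalGroup (Fin 3) ℝ) : |R 0 2| ≤ 1 := by
  have h1 : R * star R = 1 :=
    (Matrix.mem_orthogonalGroup_iff _ _).1 (Matrix.mem_specialOrthogonalGroup_iff.1 hR).1
  have h2 := congrFun (congrFun h1 0) 0
  simp [Matrix.mul_apply, Fin.sum_univ_three, Matrix.star_apply] at h2
  rw [← sq_le_one_iff_abs_le_one]
  nlinarith [sq_nonneg (R 0 0), sq_nonneg (R 0 1)]

theorem abs_tilt (R : Matrix (Fin 3) (Fin 3) ℝ) : |tilt R| = Real.arcsin |R 0 2| := by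
  rw [tilt]
  rcases le_total 0 (R 0 2) with h | h
  · rw [abs_of_nonneg h, abs_of_nonneg (Real.arcsin_nonneg.2 h)]
  · rw [abs_of_nonpos h, abs_of_nonpos (Real.arcsin_nonpos.2 h), Real.arcsin_neg]

theorem sin_abs_tilt {R : Matrix (Fin 3) (Fin 3) ℝ}
    (hR : R ∈ Matrix.specialOrthogonalGroup (Fin 3) ℝ) : Real.sin |tilt R| = |R 0 2| := by
  rw [abs_tilt, Real.sin_arcsin (by linarith [abs_nonneg (R 0 2)]) (abs_apply_le_one hR)]

theorem abs_tilt_le_abs_tilt_iff {R S : Matrix (Fin 3) (Fin 3) ℝ}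
    (hR : R ∈ Matrix.specialOrthogonalGroup (Fin 3) ℝ)
    (hS : S ∈ Matrix.specialOrthogonalGroup (Fin 3) ℝ) :
    |tilt R| ≤ |tilt S| ↔ |R 0 2| ≤ |S 0 2| := by
  rw [abs_tilt, abs_tilt, Real.strictMonoOn_arcsin.le_iff_le]
  · exact ⟨by linarith [abs_nonneg (R 0 2)], abs_apply_le_one hR⟩
  · exact ⟨by linarith [abs_nonneg (S 0 2)], abs_apply_le_one hS⟩

/-! ### Euler angles -/

theorem rot123_apply {R : Matrix (Fin 3) (Fin 3) ℝ} {a b c : ℝ}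
    (h : R = rot1 a * rot2 b * rot3 c) :
    R 0 2 = Real.sin b ∧ R 1 2 = -(Real.sin a * Real.cos b) ∧
      R 2 2 = Real.cos a * Real.cos b := by
  subst h
  simp [rot1, rot2, rot3, Matrix.mul_apply, Fin.sum_univ_three]

/-- The last three identities are two cofactor relations of a rotation and the orthogonality of its
last two columns. -/
theorem rot132_apply {R : Matrix (Fin 3) (Fin 3) ℝ} {a b c : ℝ}
    (h : R = rot1 a * rot3 b * rot2 c) :
    R 0 1 = -Real.sin b ∧ R 1 1 = Real.cos a * Real.cos b ∧ R 2 1 = Real.sin a * Real.cos b ∧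
      R 1 1 * R 2 2 - R 1 2 * R 2 1 = R 0 0 ∧ R 2 1 * R 1 0 - R 1 1 * R 2 0 = R 0 2 ∧
      R 0 1 * R 0 2 + R 1 1 * R 1 2 + R 2 1 * R 2 2 = 0 := by
  subst h
  have ha := Real.sin_sq_add_cos_sq a
  have hb := Real.sin_sq_add_cos_sq b
  refine ⟨?_, ?_, ?_, ?_, ?_, ?_⟩ <;>
    simp [rot1, rot2, rot3, Matrix.mul_apply, Fin.sum_univ_three]
  · linear_combination Real.cos b * Real.cos c * ha
  · linear_combination Real.cos b * Real.sin c * ha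
  · linear_combination Real.sin b * Real.cos b * Real.sin c * ha

/-- The difference of the first Euler angles of the two systems, in terms of the first row. -/
theorem euler_angle_sub {R : Matrix (Fin 3) (Fin 3) ℝ} {a b c a' b' c' : ℝ}
    (h : R = rot1 a * rot2 b * rot3 c) (h' : R = rot1 a' * rot3 b' * rot2 c') :
    Real.cos b * Real.cos b' * Real.cos (a' - a) = R 0 0 ∧
    Real.cos b * Real.cos b' * Real.sin (a' - a) = -(R 0 1 * R 0 2) := by
  obtain ⟨-, e12, e22⟩ := rot123_apply h
  obtain ⟨-, e11, e21, e, -, e'⟩ := rot132_apply h'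
  rw [Real.cos_sub, Real.sin_sub]
  constructor
  · rw [← e, e11, e22, e12, e21]; ring
  · have : -(R 0 1 * R 0 2) = R 1 1 * R 1 2 + R 2 1 * R 2 2 := by linarith
    rw [this, e11, e22, e12, e21]; ring

/-- A continuous angle that starts at a multiple of `2π`, has positive cosine before time `T`, and
zero cosine and positive sine at time `T`, has made a quarter turn. -/
theorem quarter_turn {D : ℝ → ℝ} (hD : Continuous D) {T : ℝ} (hT : 0 < T)
    (h0 : Real.cos (D 0) = 1) (hcos : ∀ t, 0 ≤ t → t < T → 0 < Real.cos (D t))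
    (hcosT : Real.cos (D T) = 0) (hsinT : 0 < Real.sin (D T)) : D T - D 0 = Real.pi / 2 := by
  have h0' : Real.sin (D 0) = 0 := by
    have := Real.sin_sq_add_cos_sq (D 0)
    rw [h0] at this
    exact pow_eq_zero_iff two_ne_zero |>.1 (by linarith)
  have hc : ∀ t, Real.cos (D t - D 0) = Real.cos (D t) := fun t => by
    rw [Real.cos_sub, h0, h0']; ring
  have hs : ∀ t, Real.sin (D t - D 0) = Real.sin (D t) := fun t => by
    rw [Real.sin_sub, h0, h0']; ring
  have hpi := Real.pi_pos
  -- Exceeding π/2 by time T would mean attaining it strictly earlier, where the cosine is still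
  -- positive.
  have hbound : |D T - D 0| ≤ Real.pi / 2 := by
    by_contra! hlt
    obtain ⟨r, hr, hr'⟩ := intermediate_value_Icc (f := fun t => |D t - D 0|) hT.le
      (by fun_prop) (show Real.pi / 2 ∈ _ from ⟨by simpa using (half_pos hpi).le, hlt.le⟩)
    have hr' : |D r - D 0| = Real.pi / 2 := hr'
    rcases hr.2.eq_or_lt with h | h
    · rw [h] at hr'
      linarith
    · have := hcos r hr.1 h
      rw [← hc, ← Real.cos_abs, hr', Real.cos_pi_div_two] at this
      exact this.false
  have hb := abs_le.1 hbound
  have hpos : 0 < D T - D 0 := by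
    by_contra! hneg
    have := Real.sin_nonpos_of_nonpos_of_neg_pi_le hneg (by linarith)
    rw [hs] at this
    linarith
  refine le_antisymm hb.2 ?_
  by_contra! hlt
  have := Real.cos_pos_of_mem_Ioo ⟨by linarith, hlt⟩
  rw [hc, hcosT] at this
  exact this.false

/-- The rate of the first Euler angle of the second system. -/
theorem IsMotion.hasDerivAt_euler_angle {I₁ I₂ I₃ l h : ℝ} {R : ℝ → Matrix (Fin 3) (Fin 3) ℝ}
    (hR : IsMotion I₁ I₂ I₃ l h R) {a b c : ℝ → ℝ} (ha : Differentiable ℝ a)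
    (hb : Differentiable ℝ b) (hE : ∀ t, R t = rot1 (a t) * rot3 (b t) * rot2 (c t)) (t : ℝ)
    (hrow : R t 0 0 ^ 2 + R t 0 1 ^ 2 + R t 0 2 ^ 2 = 1) (hne : 1 - R t 0 1 ^ 2 ≠ 0) :
    HasDerivAt (fun t => a t - l / I₁ * t)
      ((l / I₃ - l / I₁) * R t 0 2 ^ 2 / (1 - R t 0 1 ^ 2)) t := by
  obtain ⟨w0, w1, w2⟩ := bodyVelocity_apply I₁ I₂ I₃ l h (R t)
  obtain ⟨-, m1, -⟩ := mul_crossMatrix_apply (R t) (bodyVelocity I₁ I₂ I₃ l h (R t)) 1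
  obtain ⟨-, m2, -⟩ := mul_crossMatrix_apply (R t) (bodyVelocity I₁ I₂ I₃ l h (R t)) 2
  obtain ⟨e01, e11, e21, e, e', -⟩ := rot132_apply (hE t)
  have ha' := (ha t).hasDerivAt
  have hb' := (hb t).hasDerivAt
  have h11 := hR.hasDerivAt t 1 1
  have h21 := hR.hasDerivAt t 2 1
  rw [m1, w0, w2] at h11
  rw [m2, w0, w2] at h21
  rw [show (fun t => R t 1 1) = fun t => Real.cos (a t) * Real.cos (b t) from
    funext fun t => (rot132_apply (hE t)).2.1] at h11
  rw [show (fun t => R t 2 1) = fun t => Real.sin (a t) * Real.cos (b t) from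
    funext fun t => (rot132_apply (hE t)).2.2.1] at h21
  have u1 := h11.unique (ha'.cos.mul hb'.cos)
  have u2 := h21.unique (ha'.sin.mul hb'.cos)
  have hsa := Real.sin_sq_add_cos_sq (a t)
  have hsb := Real.sin_sq_add_cos_sq (b t)
  -- The combination R₁₁R₂₁' - R₂₁R₁₁' eliminates the rate of b, since (R₁₁, R₂₁) is cos b times the
  -- unit vector at angle a. The cofactor relations then evaluate it.
  have key : (1 - R t 0 1 ^ 2) * deriv a t =
      l * R t 0 0 / I₁ * R t 0 0 + l * R t 0 2 / I₃ * R t 0 2 := by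
    have hcb : 1 - R t 0 1 ^ 2 = Real.cos (b t) ^ 2 := by rw [e01]; linarith
    have : (1 - R t 0 1 ^ 2) * deriv a t =
        R t 1 1 * (R t 2 2 * (l * R t 0 0 / I₁) - R t 2 0 * (l * R t 0 2 / I₃)) -
        R t 2 1 * (R t 1 2 * (l * R t 0 0 / I₁) - R t 1 0 * (l * R t 0 2 / I₃)) := by
      rw [u1, u2, hcb, e11, e21]
      linear_combination -(Real.cos (b t) ^ 2 * deriv a t) * hsa
    rw [this]
    linear_combination (l * R t 0 0 / I₁) * e + (l * R t 0 2 / I₃) * e'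
  refine (ha'.sub ((hasDerivAt_id t).const_mul (l / I₁))).congr_deriv ?_
  rw [eq_div_iff hne]
  linear_combination key + l / I₁ * hrow

end TwistingSomersault

/-! ### Assembly of the main theorem -/

set_option maxHeartbeats 400000 in
theorem mainTheorem9
    (I₁ I₂ I₃ l h : ℝ) (hI₃ : 0 < I₃) (hI₃₁ : I₃ < I₁) (hI₁₂ : I₁ < I₂) (hl : 0 < l) (hh : h ≠ 0)
    -- the ``rotor on'' motion, and its two systems of Euler angles
    (R : ℝ → Matrix (Fin 3) (Fin 3) ℝ)
    (hR : TwistingSomersault.IsMotion I₁ I₂ I₃ l h R)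
    (φ θ ψ φ' θ' ψ' : ℝ → ℝ)
    (hφ : Differentiable ℝ φ) (hθ : Differentiable ℝ θ) (hψ : Differentiable ℝ ψ)
    (hφ' : Differentiable ℝ φ') (hθ' : Differentiable ℝ θ') (hψ' : Differentiable ℝ ψ')
    (hEuler : ∀ t, R t = TwistingSomersault.rot1 (φ t) * TwistingSomersault.rot2 (θ t) *
      TwistingSomersault.rot3 (ψ t))
    (hEuler' : ∀ t, R t = TwistingSomersault.rot1 (φ' t) * TwistingSomersault.rot3 (θ' t) *
      TwistingSomersault.rot2 (ψ' t))
    -- it starts at the body angular momentum `(l, 0, 0)`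
    (hθ₀ : θ 0 = 0) (hψ₀ : ψ 0 = 0) (hθ'₀ : θ' 0 = 0) (hψ'₀ : ψ' 0 = 0) :
    -- `T₂` is the first time at which the tilt is maximal along the orbit
    ∃ T₂ : ℝ,
      IsLeast {t : ℝ | 0 < t ∧
        ∀ t', |TwistingSomersault.tilt (R t')| ≤ |TwistingSomersault.tilt (R t)|} T₂ ∧
      ∃ s : ℝ, 0 < s ∧ s < 1 ∧
        s ^ 2 = Real.sin |TwistingSomersault.tilt (R T₂)| ^ 2 +
          (1 - Real.sin |TwistingSomersault.tilt (R T₂)| ^ 2) *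
            TwistingSomersault.nu I₁ I₂ I₃ ∧
        -- `s` is the sine of the minimal tilt of the ``rotor off'' motion that follows
        (∀ R₃ : ℝ → Matrix (Fin 3) (Fin 3) ℝ,
          TwistingSomersault.IsMotion I₁ I₂ I₃ l 0 R₃ → R₃ T₂ = R T₂ →
          IsLeast (Set.range fun t => Real.sin |TwistingSomersault.tilt (R₃ t)|) s) ∧
        TwistingSomersault.kSq s (TwistingSomersault.nu I₁ I₂ I₃) < 1 ∧
        TwistingSomersault.nPlus s (TwistingSomersault.nu I₁ I₂ I₃) < 1 ∧
        TwistingSomersault.nMinus s (TwistingSomersault.nu I₁ I₂ I₃) < 1 ∧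
        (φ' T₂ - φ' 0) - l / I₁ * T₂ =
          TwistingSomersault.fPlus s (TwistingSomersault.nu I₁ I₂ I₃) *
            TwistingSomersault.ellipticPi
              (TwistingSomersault.nPlus s (TwistingSomersault.nu I₁ I₂ I₃))
              (TwistingSomersault.kSq s (TwistingSomersault.nu I₁ I₂ I₃)) +
          TwistingSomersault.fMinus s (TwistingSomersault.nu I₁ I₂ I₃) *
            TwistingSomersault.ellipticPi
              (TwistingSomersault.nMinus s (TwistingSomersault.nu I₁ I₂ I₃))
              (TwistingSomersault.kSq s (TwistingSomersault.nu I₁ I₂ I₃)) ∧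
        φ T₂ - φ 0 = (φ' T₂ - φ' 0) - Real.pi / 2 := by

  have hI₁ : 0 < I₁ := hI₃.trans hI₃₁
  have hI₂ : 0 < I₂ := hI₁.trans hI₁₂
  -- Multiplying the last two coordinates by the sign of h, with an extra minus on the third,
  -- reduces both signs of h to the system with H > 0.
  obtain ⟨σ, hσ, hσh⟩ : ∃ σ : ℝ, σ ^ 2 = 1 ∧ 0 < σ * h := by
    rcases lt_or_gt_of_ne hh with hneg | hpos
    · exact ⟨-1, by norm_num, by linarith⟩
    · exact ⟨1, by norm_num, by linarith⟩
  set ν := TwistingSomersault.nu I₁ I₂ I₃ with hνdef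
  obtain ⟨K₂, hK₂def⟩ : ∃ K₂, K₂ = l / I₃ - l / I₁ := ⟨_, rfl⟩
  obtain ⟨K₃, hK₃def⟩ : ∃ K₃, K₃ = l / I₁ - l / I₂ := ⟨_, rfl⟩
  have hK₁ : l / I₃ - l / I₂ = K₂ + K₃ := by rw [hK₂def, hK₃def]; ring
  have hK₂ : 0 < K₂ := by
    rw [hK₂def, sub_pos]
    exact div_lt_div_of_pos_left hl hI₃ hI₃₁
  have hK₃ : 0 < K₃ := by
    rw [hK₃def, sub_pos]
    exact div_lt_div_of_pos_left hl hI₁ hI₁₂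
  have hνK : K₂ * ν = -K₃ := by
    have h1 : I₁ / I₃ - 1 ≠ 0 := by
      have := (one_lt_div hI₃).2 hI₃₁
      linarith
    have h2 : K₂ = l / I₁ * (I₁ / I₃ - 1) := by rw [hK₂def]; field_simp
    rw [hνdef, TwistingSomersault.nu, h2, mul_assoc, mul_div_cancel₀ _ h1, hK₃def]
    field_simp
    ring
  have hν : ν < 0 := by
    by_contra! hn
    linarith [mul_nonneg hK₂.le hn]
  -- the normalised orbit
  have hrow := hR.hasDerivAt_row
  rw [hK₁, ← hK₂def, ← hK₃def] at hrow
  have hH : 0 < σ * h / I₂ := div_pos hσh hI₂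
  have hx := fun t => (hrow t).1
  have hy : ∀ t, HasDerivAt (fun t => σ * R t 0 1) (K₂ * (R t 0 0 * (-σ * R t 0 2))) t :=
    fun t => ((hrow t).2.1.const_mul σ).congr_deriv (by ring)
  have hz : ∀ t, HasDerivAt (fun t => -σ * R t 0 2)
      (R t 0 0 * (K₃ * (σ * R t 0 1) + σ * h / I₂)) t :=
    fun t => ((hrow t).2.2.const_mul (-σ)).congr_deriv (by ring)
  have hx' : ∀ t, HasDerivAt (fun t => R t 0 0)
      (-(-σ * R t 0 2 * ((K₂ + K₃) * (σ * R t 0 1) + σ * h / I₂))) t := fun t =>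
    (hx t).congr_deriv (by
      linear_combination -(R t 0 2 * ((K₂ + K₃) * R t 0 1 + h / I₂)) * hσ)
  have h0 := TwistingSomersault.rot132_apply (hEuler' 0)
  have h0' := TwistingSomersault.rot123_apply (hEuler 0)
  have hx0 : R 0 0 0 = 1 := by
    rw [hEuler' 0, hθ'₀, hψ'₀]
    simp [TwistingSomersault.rot1, TwistingSomersault.rot2, TwistingSomersault.rot3,
      Matrix.mul_apply, Fin.sum_univ_three]
  have hy0 : σ * R 0 0 1 = 0 := by rw [h0.1, hθ'₀]; simp
  have hz0 : -σ * R 0 0 2 = 0 := by rw [h0'.1, hθ₀]; simp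
  have cons := TwistingSomersault.rotorOn_conserved hK₃ hK₂ hH hx' hy hz hx0 hy0 hz0
  obtain ⟨T, hT, hxT, hxpos, hzpos, hmono⟩ :=
    TwistingSomersault.rotorOn_quarter hK₃ hK₂ hH hx' hy hz hx0 hy0 hz0
  have hz_sq : ∀ t, (-σ * R t 0 2) ^ 2 = R t 0 2 ^ 2 := fun t => by
    linear_combination R t 0 2 ^ 2 * hσ
  have hy_sq : ∀ t, (σ * R t 0 1) ^ 2 = R t 0 1 ^ 2 := fun t => by
    linear_combination R t 0 1 ^ 2 * hσ
  obtain ⟨H, hHdef⟩ : ∃ H, H = σ * h / I₂ := ⟨_, rfl⟩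
  simp only [← hHdef] at cons hH
  clear hx' hz
  obtain ⟨y, hydef⟩ : ∃ y : ℝ → ℝ, y = fun t => σ * R t 0 1 := ⟨_, rfl⟩
  have hyt : ∀ t, σ * R t 0 1 = y t := fun t => by rw [hydef]
  rw [← hydef] at hmono hy
  simp only [hz_sq, hyt] at cons hy_sq hy0
  obtain ⟨p, hpdef⟩ : ∃ p, y T = p := ⟨_, rfl⟩
  have hp : 0 < p := by
    have := hmono ⟨le_rfl, hT.le⟩ ⟨hT.le, le_rfl⟩ hT
    rwa [hy0, hpdef] at this
  have hzT : R T 0 2 ^ 2 = 1 - p ^ 2 := by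
    have := (cons T).1
    rw [hxT, hpdef] at this
    linarith
  have hEn : K₂ * (1 - p ^ 2) = 2 * H * p + K₃ * p ^ 2 := by
    rw [← hzT, (cons T).2.1, hpdef]
  -- the minimal tilt
  have hs2pos : 0 < 1 - (1 - ν) * p ^ 2 := by
    -- This is the energy relation at T, with K₃ = -K₂ν.
    have h1 : K₂ * (1 - (1 - ν) * p ^ 2) = 2 * H * p := by
      linear_combination hEn + p ^ 2 * hνK
    have h2 : 0 < 2 * H * p := by positivity
    rw [← h1] at h2
    exact (mul_pos_iff_of_pos_left hK₂).1 h2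
  obtain ⟨s, hsdef⟩ : ∃ s, s = Real.sqrt (1 - (1 - ν) * p ^ 2) := ⟨_, rfl⟩
  have hs : 0 < s := by rw [hsdef]; exact Real.sqrt_pos.2 hs2pos
  have hs2 : s ^ 2 = 1 - (1 - ν) * p ^ 2 := by rw [hsdef, Real.sq_sqrt hs2pos.le]
  have hps : p ^ 2 * (1 - ν) = 1 - s ^ 2 := by linarith
  have hs2lt : s ^ 2 < 1 := by
    have : 0 < p ^ 2 * (1 - ν) := mul_pos (by positivity) (by linarith)
    linarith
  have hs1 : s < 1 := (sq_lt_one_iff₀ hs.le).1 hs2lt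
  have hsK : K₂ * s ^ 2 = 2 * H * p := by
    rw [hs2]
    linear_combination hEn + p ^ 2 * hνK
  -- Eliminating H by K₂s² = 2Hp expresses the energy through s, ν and p alone; the sphere then
  -- gives x² in factored form.
  have hz2 : ∀ t, R t 0 2 ^ 2 = s ^ 2 * (y t / p) - ν * y t ^ 2 := by
    intro t
    refine mul_left_cancel₀ hK₂.ne' ?_
    rw [(cons t).2.1]
    field_simp
    linear_combination -(y t) * hsK + p * y t ^ 2 * hνK
  have hx2 : ∀ t, R t 0 0 ^ 2 = (1 - y t / p) * (1 + (1 - s ^ 2) * (y t / p)) := by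
    intro t
    have h1 : (1 - s ^ 2) * (y t / p) ^ 2 = (1 - ν) * y t ^ 2 := by
      rw [← hps]
      field_simp
    linear_combination (cons t).1 - hz2 t + h1
  have hyp : ∀ t, y t ≤ p := by
    intro t
    have h1 := hx2 t ▸ sq_nonneg (R t 0 0)
    have hu : 0 ≤ y t / p := div_nonneg (cons t).2.2 hp.le
    have h2 : 0 < 1 + (1 - s ^ 2) * (y t / p) := by
      have := mul_nonneg (by linarith : 0 ≤ 1 - s ^ 2) hu
      linarith
    have h3 := nonneg_of_mul_nonneg_left h1 h2
    exact (div_le_one hp).1 (by linarith)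
  -- The second factor is positive, so |tilt| is maximal only when y = p. Then x = 0, which does not
  -- happen in (0, T).
  have hmax : ∀ t, K₂ * (R T 0 2 ^ 2 - R t 0 2 ^ 2) = (p - y t) * (2 * H + K₃ * (p + y t)) := by
    intro t
    have h1 := (cons T).2.1
    rw [hpdef] at h1
    linear_combination h1 - (cons t).2.1
  have hfac : ∀ t, 0 < 2 * H + K₃ * (p + y t) := fun t => by
    have := (cons t).2.2
    positivity
  have hzle : ∀ t, R t 0 2 ^ 2 ≤ R T 0 2 ^ 2 := by
    intro t
    have h1 := mul_nonneg (sub_nonneg.2 (hyp t)) (hfac t).le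
    rw [← hmax t] at h1
    exact sub_nonneg.1 (nonneg_of_mul_nonneg_right h1 hK₂)
  have hz1 : ∀ t, R t 0 2 ^ 2 < 1 := fun t => by
    linarith [hzle t, pow_pos hp 2]
  have hs1' : 0 < 1 - p ^ 2 := by
    have h1 : 0 ≤ -ν * p ^ 2 := mul_nonneg (by linarith) (sq_nonneg p)
    linarith [pow_pos hs 2]
  have hy1 : ∀ t, 0 < 1 - R t 0 1 ^ 2 := fun t => by
    rw [← hy_sq]
    linarith [pow_le_pow_left₀ (cons t).2.2 (hyp t) 2]
  refine ⟨T, ⟨⟨hT, fun t => ?_⟩, ?_⟩, s, hs, hs1, ?_, ?_, ?_⟩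
  · rw [TwistingSomersault.abs_tilt_le_abs_tilt_iff (hR.rotation _) (hR.rotation _)]
    exact sq_le_sq.1 (hzle t)
  · rintro t ⟨ht, hall⟩
    have h1 := hall T
    rw [TwistingSomersault.abs_tilt_le_abs_tilt_iff (hR.rotation _) (hR.rotation _),
      ← sq_le_sq] at h1
    have h2 := hmax t
    rw [le_antisymm h1 (hzle t), sub_self, mul_zero, zero_eq_mul] at h2
    have h3 := h2.resolve_right (hfac t).ne'
    have h4 := hx2 t
    rw [show y t = p by linarith, div_self hp.ne', sub_self, zero_mul] at h4
    by_contra! hlt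
    exact (hxpos t ht.le hlt).ne' (pow_eq_zero_iff two_ne_zero |>.1 h4)
  · rw [TwistingSomersault.sin_abs_tilt (hR.rotation _), sq_abs, hzT, hs2]
    ring
  · intro R₃ hR₃ hRT
    have hrow₃ := hR₃.hasDerivAt_row
    rw [hK₁, ← hK₂def, ← hK₃def] at hrow₃
    simp only [TwistingSomersault.sin_abs_tilt (hR₃.rotation _)]
    -- The attitude is unchanged at the switch, so the rotor-off invariant is evaluated at T.
    refine TwistingSomersault.rotorOff_isLeast (x₁ := fun t => R₃ t 0 0)
      (x₂ := fun t => R₃ t 0 1) (t₀ := T) hK₂ hK₃.le hs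
      (fun t => (hrow₃ t).1.congr_deriv (by ring)) (fun t => (hrow₃ t).2.1)
      (fun t => (hrow₃ t).2.2.congr_deriv (by ring)) ?_
    rw [hRT, ← hy_sq, hpdef, hzT, hs2]
    linear_combination -p ^ 2 * hνK
  obtain ⟨hk, hn1, hn2⟩ := TwistingSomersault.params_lt_one hs hs1 hν hp hps
  refine ⟨hk, hn1, hn2, ?_, ?_⟩
  · rw [← TwistingSomersault.twist_eq (z := fun t => -σ * R t 0 2)
      (E := fun t => φ' t - l / I₁ * t) hs hs1 hν hp hps hT hy hy0 hpdef hmono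
      (fun t ht htT => hxpos t ht.le htT) (fun t ht htT => hzpos t ht htT.le) hx2
      (fun t => (hz_sq t).trans (hz2 t)) (fun t _ => ?_)]
    · ring
    · have := hR.hasDerivAt_euler_angle hφ' hθ' hEuler' t
        (by rw [← (cons t).1, ← hy_sq]) (hy1 t).ne'
      rwa [← hK₂def, ← hy_sq, ← hz_sq] at this
  -- Neither Euler system degenerates, as |R₀₂| < 1 and |R₀₁| < 1 throughout; both cosines keep
  -- their initial sign.
  · have hcosθ : ∀ t, 0 < Real.cos (θ t) := by
      refine TwistingSomersault.pos_of_continuous_of_ne_zero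
        (Real.continuous_cos.comp hθ.continuous) (fun t ht => ?_) (a := 0) (by simp [hθ₀])
      have h1 := Real.sin_sq_add_cos_sq (θ t)
      have h2 := hz1 t
      rw [(TwistingSomersault.rot123_apply (hEuler t)).1] at h2
      rw [ht] at h1
      linarith
    have hcosθ' : ∀ t, 0 < Real.cos (θ' t) := by
      refine TwistingSomersault.pos_of_continuous_of_ne_zero
        (Real.continuous_cos.comp hθ'.continuous) (fun t ht => ?_) (a := 0) (by simp [hθ'₀])
      have h1 := Real.sin_sq_add_cos_sq (θ' t)
      have h2 := hy1 t
      rw [(TwistingSomersault.rot132_apply (hEuler' t)).1] at h2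
      rw [ht] at h1
      linarith
    have hsub := fun t => TwistingSomersault.euler_angle_sub (hEuler t) (hEuler' t)
    have hpos := fun t => mul_pos (hcosθ t) (hcosθ' t)
    have hq := TwistingSomersault.quarter_turn (D := fun t => φ' t - φ t)
      (hφ'.continuous.sub hφ.continuous) hT
      (by have := (hsub 0).1; rwa [hθ₀, hθ'₀, hx0, Real.cos_zero, one_mul, one_mul] at this)
      (fun t ht htT => (mul_pos_iff_of_pos_left (hpos t)).1
        (by rw [(hsub t).1]; exact hxpos t ht htT))
      ((mul_eq_zero_iff_left (hpos T).ne').1 (by rw [(hsub T).1]; exact hxT))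
      ((mul_pos_iff_of_pos_left (hpos T)).1 (by
        rw [(hsub T).2]
        have h1 := mul_pos (hpdef ▸ hp) (hzpos T hT le_rfl)
        rw [← hyt] at h1
        linear_combination h1 - (R T 0 1 * R T 0 2) * hσ))
    linarith
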